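/- Let $\mathcal S_1,\mathcal S_2,\mathcal X,\mathcal Y,\hat{\mathcal S}_1$ be finite sets, let $p(s_1)$, $p(s_2)$ be probability mass functions on $\mathcal S_1,\mathcal S_2$, let $p(y\mid x,s_1,s_2)$ be a channel, and let $d:\mathcal S_1\times\hat{\mathcal S}_1\to\mathbb R$ (distortion), $\rho:\mathcal X\to\mathbb R$ (cost) and $C\in\mathbb R$. Let $S_1^n\sim\prod_i p(s_{1i})$ and $S_2^n\sim\prod_i p(s_{2i})$ be independent. An $(n,C)$ code (interference known noncausally at the helper) consists of maps $f_n:\mathcal S_2^n\to\mathcal X^n$ and $g_n:\mathcal Y^n\to\hat{\mathcal S}_1^n$ with $\mathbb E\,\frac1n\sum_{i=1}^n\rho(X_i)\le C$, where $X^n=f_n(S_2^n)$; the channel is memoryless, $p(y^n\mid x^n,s_1^n,s_2^n)=\prod_i p(y_i\mid x_i,s_{1i},s_{2i})$, and $\hat S_1^n=g_n(Y^n)$. A distortion $D\in\mathbb R$ is achievable under the cost constraint $C$ if there are $\epsilon_n\to0$ and a sequence of $(n,C+\epsilon_n)$ codes with $\limsup_{n\to\infty}\mathbb E\,\frac1n\sum_{i=1}^n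 d(S_{1i},\hat S_{1i})\le D$, and $D(C)_{\min}$ is the infimum of the achievable distortions. Then $$D(C)_{\min}\;\le\;\inf\ \mathbb E\, d\big(S_1,\hat s_1(U,Y)\big),$$ where the infimum is over all finite sets $\mathcal U$, conditional distributions $p(u\mid s_2)$ on $\mathcal U$, and functions $x=f(s_2,u)$ and $\hat s_1(u,y)$ such that, for $(S_1,S_2,U,Y)\sim p(s_1)\,p(s_2)\,p(u\mid s_2)\,p(y\mid f(s_2,u),s_1,s_2)$ and $X=f(S_2,U)$, $$I(U;Y)>I(U;S_2),\qquad \mathbb E\,\rho(X)\le C .$$ (Infima over the empty set are $+\infty$.) Moreover, if at least one such choice exists, the infimum on the right is a finite number and is itself an achievable distortion under the cost constraint $C$. -/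

import Mathlib

open Filter Topology

noncomputable section

/-- Mutual information `I(A;B)` (in nats) of a pair of finite random variables with joint
probability mass function `r`. Terms with `r a b = 0` vanish. -/
def mutualInfo {A B : Type*} [Fintype A] [Fintype B] (r : A → B → ℝ) : ℝ :=
  ∑ a, ∑ b, r a b * Real.log (r a b / ((∑ b', r a b') * (∑ a', r a' b)))

/-- A discrete memoryless problem of estimation with a helper: finite alphabets for the desired
signal `S₁`, the interference `S₂`, the helper's output `X`, the channel output `Y` and the
reconstruction `R`; probability mass functions of the independent sources `S₁` and `S₂`; the
channel `W x s₁ s₂ y = p(y | x, s₁, s₂)`; a distortion measure and a cost function. -/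
structure HelperProblem (S₁ S₂ X Y R : Type*)
    [Fintype S₁] [Fintype S₂] [Fintype X] [Fintype Y] [Fintype R] where
  p₁ : S₁ → ℝ
  p₁_mem : p₁ ∈ stdSimplex ℝ S₁
  p₂ : S₂ → ℝ
  p₂_mem : p₂ ∈ stdSimplex ℝ S₂
  W : X → S₁ → S₂ → Y → ℝ
  W_mem : ∀ x s₁ s₂, W x s₁ s₂ ∈ stdSimplex ℝ Y
  d : S₁ → R → ℝ
  ρ : X → ℝ

namespace HelperProblem

section

variable {S₁ S₂ X Y R : Type*} [Fintype S₁] [Fintype S₂] [Fintype X] [Fintype Y] [Fintype R]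

/-- Joint law of `(S₁ⁿ, S₂ⁿ, Yⁿ)`, with i.i.d. independent sources, a memoryless channel and
`Xⁿ = enc(S₂ⁿ)`, the interference being known noncausally. -/
def blockLaw (P : HelperProblem S₁ S₂ X Y R) {n : ℕ} (enc : (Fin n → S₂) → (Fin n → X))
    (s₁ : Fin n → S₁) (s₂ : Fin n → S₂) (y : Fin n → Y) : ℝ :=
  (∏ i, P.p₁ (s₁ i)) * (∏ i, P.p₂ (s₂ i)) * ∏ i, P.W (enc s₂ i) (s₁ i) (s₂ i) (y i)

/-- `E (∑ᵢ ρ(Xᵢ)) / n` for `Xⁿ = enc(S₂ⁿ)`. -/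
def blockCost (P : HelperProblem S₁ S₂ X Y R) {n : ℕ}
    (enc : (Fin n → S₂) → (Fin n → X)) : ℝ :=
  ∑ s₂ : Fin n → S₂, (∏ i, P.p₂ (s₂ i)) * ((∑ i, P.ρ (enc s₂ i)) / n)

/-- `E (∑ᵢ d(S₁ᵢ, Ŝ₁ᵢ)) / n` for `Xⁿ = enc(S₂ⁿ)` and `Ŝ₁ⁿ = dec(Yⁿ)`. -/
def blockDistortion (P : HelperProblem S₁ S₂ X Y R) {n : ℕ}
    (enc : (Fin n → S₂) → (Fin n → X)) (dec : (Fin n → Y) → (Fin n → R)) : ℝ :=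
  ∑ s₁ : Fin n → S₁, ∑ s₂ : Fin n → S₂, ∑ y : Fin n → Y,
    P.blockLaw enc s₁ s₂ y * ((∑ i, P.d (s₁ i) (dec y i)) / n)

/-- An `(n, C)` code with noncausal knowledge of the interference at the helper. -/
structure Code (P : HelperProblem S₁ S₂ X Y R) (n : ℕ) (C : ℝ) where
  enc : (Fin n → S₂) → (Fin n → X)
  dec : (Fin n → Y) → (Fin n → R)
  cost_le : P.blockCost enc ≤ C

/-- The distortion `D` is achievable under the cost constraint `C`. -/
def Achievable (P : HelperProblem S₁ S₂ X Y R) (C D : ℝ) : Prop :=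
  ∃ (ε : ℕ → ℝ) (code : ∀ n : ℕ, P.Code n (C + ε n)),
    Tendsto ε atTop (𝓝 0) ∧
    limsup (fun n : ℕ => (P.blockDistortion (code n).enc (code n).dec : EReal)) atTop ≤ (D : EReal)

/-- The minimum achievable distortion: the infimum of the achievable distortions
(`⊤` when there are none). -/
def minDistortion (P : HelperProblem S₁ S₂ X Y R) (C : ℝ) : EReal :=
  ⨅ (D : ℝ) (_ : P.Achievable C D), (D : EReal)

/-- A single-letter choice: a conditional distribution `q s₂ u = p(u | s₂)` of an auxiliary random
variable with finite alphabet `U`, and functions `x = f(s₂, u)` and `ŝ₁ = g(u, y)`. -/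
structure HybridChoice (P : HelperProblem S₁ S₂ X Y R) (U : Type*) [Fintype U] where
  q : S₂ → U → ℝ
  q_mem : ∀ s₂, q s₂ ∈ stdSimplex ℝ U
  f : S₂ → U → X
  g : U → Y → R

namespace HybridChoice

variable {P : HelperProblem S₁ S₂ X Y R} {U : Type*} [Fintype U]

/-- Joint law of `(S₁, S₂, U, Y)`: `p(s₁) p(s₂) p(u | s₂) p(y | f(s₂, u), s₁, s₂)`. -/
def law (h : P.HybridChoice U) (s₁ : S₁) (s₂ : S₂) (u : U) (y : Y) : ℝ :=
  P.p₁ s₁ * P.p₂ s₂ * h.q s₂ u * P.W (h.f s₂ u) s₁ s₂ y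

/-- `I(U; Y)`. -/
def infoUY (h : P.HybridChoice U) : ℝ :=
  mutualInfo fun u y => ∑ s₁, ∑ s₂, h.law s₁ s₂ u y

/-- `I(U; S₂)`. -/
def infoUS (h : P.HybridChoice U) : ℝ :=
  mutualInfo fun u s₂ => P.p₂ s₂ * h.q s₂ u

/-- `E ρ(X)` for `X = f(S₂, U)`. -/
def cost (h : P.HybridChoice U) : ℝ :=
  ∑ s₂, ∑ u, P.p₂ s₂ * h.q s₂ u * P.ρ (h.f s₂ u)

/-- `E d(S₁, Ŝ₁)` for `Ŝ₁ = g(U, Y)`. -/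
def distortion (h : P.HybridChoice U) : ℝ :=
  ∑ s₁, ∑ s₂, ∑ u, ∑ y, h.law s₁ s₂ u y * P.d s₁ (h.g u y)

end HybridChoice

/-- The values `E d(S₁, Ŝ₁(U, Y))` over all choices of a finite auxiliary alphabet (`{0,…,k-1}`
up to relabelling), `p(u | s₂)`, `f` and `ŝ₁` with `I(U;Y) > I(U;S₂)` and `E ρ(X) ≤ C`. -/
def hybridDistortions (P : HelperProblem S₁ S₂ X Y R) (C : ℝ) : Set ℝ :=
  {D | ∃ (k : ℕ) (h : P.HybridChoice (Fin k)),
    h.infoUY > h.infoUS ∧ h.cost ≤ C ∧ h.distortion = D}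

end

end HelperProblem

end

/-!
For every single-letter choice `(U, q, f, g)` with `I(U;S₂) < I(U;Y)`, hybrid coding gives block
codes whose cost and distortion exceed the single-letter values by arbitrarily little; the infimum
is then reached by a diagonal argument.

*One-shot bound* (`exists_hybrid_code`). Draw a codebook `c : Fin M → U` with independent entries
of law `p(u)`. Given `s₂`, the helper has to pick an index `m` so that the codeword `c m` looks
jointly generated with `s₂`, and the decoder has to recover `c m` from `y`. The usual difficulty is
that the index depends on the whole codebook. It is avoided by comparison with the ideal law in
which `m` is uniform and `s₂` is drawn from `p(s₂ | c m)`. The helper picks the index with the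
smallest conditional failure probability `b m s₂`. If `Q` is the marginal of `S₂` under the ideal
law, then
`p(s₂) min_m b m s₂ ≤ (p(s₂) - Q(s₂))⁺ + (1 / M) ∑ m, p(s₂ | c m) b m s₂`,
so the failure probability is at most a soft-covering error plus the failure probability under
the ideal law. On average over the codebook the first is small as soon as `M` exceeds
`exp I(U;S₂)` (`iidExp_covering_le`, a second-moment computation), and the second, which is plain
channel coding with a threshold decoder, as soon as `M` is below `exp I(U;Y)`
(`iidExp_packing_le`, a union bound).

*Block codes*. The bound is applied to the product alphabets with `M ≈ exp (n R)` for a rate `R`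
between the two informations. By the weak law of large numbers (`iidExp_not_isTypical_le`) the two
information densities, the cost and the distortion of a block are simultaneously close to their
means. The cost and the distortion bounds are part of the event whose failure is controlled, hence
a single codebook with small failure probability serves for both, and
the expectations follow since `ρ` and `d` are bounded (`exists_code_le`).

*Diagonal argument* (`achievable_of_eventually`). For each block length there are finitely many
pairs of maps, and the one with the least slack in cost and distortion gives a code sequence whose
slack tends to zero.
-/

/-! ### Sums of independent letters -/

/-- The expectation of `F c` for a tuple `c` of independent entries, each with weight function `w`. -/
def iidExp {ι α : Type*} [Fintype ι] [DecidableEq ι] [Fintype α] (w : α → ℝ)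
    (F : (ι → α) → ℝ) : ℝ :=
  ∑ c, (∏ i, w (c i)) * F c

section iidExp

variable {ι α : Type*} [Fintype ι] [DecidableEq ι] [Fintype α] {w : α → ℝ}

lemma iidExp_add (F G : (ι → α) → ℝ) :
    iidExp w (fun c => F c + G c) = iidExp w F + iidExp w G := by
  simp only [iidExp, mul_add, Finset.sum_add_distrib]

lemma iidExp_mul_left (a : ℝ) (F : (ι → α) → ℝ) :
    iidExp w (fun c => a * F c) = a * iidExp w F := by
  simp only [iidExp, Finset.mul_sum]
  exact Finset.sum_congr rfl fun c _ => by ring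

lemma iidExp_sum {κ : Type*} (s : Finset κ) (F : κ → (ι → α) → ℝ) :
    iidExp w (fun c => ∑ k ∈ s, F k c) = ∑ k ∈ s, iidExp w (F k) := by
  simp only [iidExp, Finset.mul_sum]
  exact Finset.sum_comm

lemma iidExp_mono (hw : ∀ a, 0 ≤ w a) {F G : (ι → α) → ℝ} (h : ∀ c, F c ≤ G c) :
    iidExp w F ≤ iidExp w G :=
  Finset.sum_le_sum fun c _ =>
    mul_le_mul_of_nonneg_left (h c) (Finset.prod_nonneg fun _ _ => hw _)

lemma sum_prod_apply (v : ι → α → ℝ) : ∑ c : ι → α, ∏ i, v i (c i) = ∏ i, ∑ a, v i a :=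
  (Fintype.prod_sum v).symm

lemma iidExp_const (hw1 : ∑ a, w a = 1) (a : ℝ) : iidExp w (fun _ : ι → α => a) = a := by
  simp only [iidExp, ← Finset.sum_mul, sum_prod_apply (fun _ : ι => w), hw1]
  simp

/-- Some outcome is at most the expectation. -/
lemma exists_le_iidExp (hw : ∀ a, 0 ≤ w a) (hw1 : ∑ a, w a = 1) (F : (ι → α) → ℝ) :
    ∃ c, F c ≤ iidExp w F := by
  have hone : ∑ c : ι → α, ∏ i, w (c i) = 1 := by
    simp [sum_prod_apply (fun _ : ι => w), hw1]
  by_contra! hlt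
  obtain ⟨c, -, hc⟩ := Finset.exists_ne_zero_of_sum_ne_zero (hone.trans_ne one_ne_zero)
  have hnn : ∀ c : ι → α, 0 ≤ ∏ i, w (c i) := fun c => Finset.prod_nonneg fun i _ => hw _
  have : ∑ c : ι → α, (∏ i, w (c i)) * iidExp w F < ∑ c : ι → α, (∏ i, w (c i)) * F c :=
    Finset.sum_lt_sum (fun c _ => mul_le_mul_of_nonneg_left (hlt c).le (hnn c))
      ⟨c, Finset.mem_univ c,
        mul_lt_mul_of_pos_left (hlt c) (lt_of_le_of_ne (hnn c) (Ne.symm hc))⟩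
  rw [← Finset.sum_mul, hone, one_mul] at this
  exact lt_irrefl _ this

lemma iidExp_coord (hw1 : ∑ a, w a = 1) (i : ι) (f : α → ℝ) :
    iidExp w (fun c : ι → α => f (c i)) = ∑ a, w a * f a := by
  have h : ∀ c : ι → α, (∏ k, w (c k)) * f (c i)
      = ∏ k, (w (c k) * if k = i then f (c k) else 1) := by
    intro c
    rw [Finset.prod_mul_distrib]
    simp
  simp only [iidExp, h]
  rw [sum_prod_apply (fun k a => w a * if k = i then f a else 1), Finset.prod_eq_single i]
  · simp
  · intro k _ hk
    simp [hk, hw1]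
  · simp

lemma iidExp_coord_mul_coord (hw1 : ∑ a, w a = 1) {i j : ι} (hij : i ≠ j) (f g : α → ℝ) :
    iidExp w (fun c : ι → α => f (c i) * g (c j)) = (∑ a, w a * f a) * ∑ a, w a * g a := by
  have h : ∀ c : ι → α, (∏ k, w (c k)) * (f (c i) * g (c j))
      = ∏ k, (w (c k) * ((if k = i then f (c k) else 1) * if k = j then g (c k) else 1)) := by
    intro c
    rw [Finset.prod_mul_distrib, Finset.prod_mul_distrib]
    simp
  simp only [iidExp, h]
  rw [sum_prod_apply (fun k a => w a * ((if k = i then f a else 1) * if k = j then g a else 1)),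
    Finset.prod_eq_mul i j hij]
  · simp [hij, hij.symm]
  · rintro k _ ⟨hk, hk'⟩
    simp [hk, hk', hw1]
  · simp
  · simp

lemma iidExp_coord₂ (hw1 : ∑ a, w a = 1) {i j : ι} (hij : i ≠ j) (F : α → α → ℝ) :
    iidExp w (fun c : ι → α => F (c i) (c j)) = ∑ a, ∑ b, w a * w b * F a b := by
  classical
  have h : ∀ c : ι → α, F (c i) (c j)
      = ∑ a, ∑ b, F a b * ((if c i = a then 1 else 0) * if c j = b then 1 else 0) := by
    intro c
    simp
  simp only [h, iidExp_sum, iidExp_mul_left]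
  refine Finset.sum_congr rfl fun a _ => Finset.sum_congr rfl fun b _ => ?_
  rw [iidExp_coord_mul_coord hw1 hij (fun x => if x = a then 1 else 0)
    (fun x => if x = b then 1 else 0)]
  simp
  ring

/-- The variance of a sum of independent centred terms is the sum of the variances. -/
lemma iidExp_sq_sum_of_centred (hw1 : ∑ a, w a = 1) (f : α → ℝ) (hf : ∑ a, w a * f a = 0) :
    iidExp w (fun c : ι → α => (∑ i, f (c i)) ^ 2) = Fintype.card ι * ∑ a, w a * f a ^ 2 := by
  have h : ∀ c : ι → α, (∑ i, f (c i)) ^ 2 = ∑ i, ∑ j, f (c i) * f (c j) := fun c => by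
    rw [sq, Finset.sum_mul_sum]
  simp only [h, iidExp_sum]
  have h2 : ∀ i : ι, ∑ j, iidExp w (fun c : ι → α => f (c i) * f (c j)) = ∑ a, w a * f a ^ 2 := by
    intro i
    rw [Finset.sum_eq_single i]
    · rw [iidExp_coord hw1 i (fun x => f x * f x)]
      simp only [sq]
    · intro j _ hj
      rw [iidExp_coord_mul_coord hw1 hj.symm, hf, zero_mul]
    · simp
  simp [h2]

lemma iidExp_sq_sum_sub_mean_le (hw1 : ∑ a, w a = 1) (f : α → ℝ) :
    iidExp w (fun c : ι → α => (∑ i, f (c i) - Fintype.card ι * ∑ a, w a * f a) ^ 2)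
      ≤ Fintype.card ι * ∑ a, w a * f a ^ 2 := by
  set m := ∑ a, w a * f a with hm
  have hc : ∑ a, w a * (f a - m) = 0 := by
    simp only [mul_sub, Finset.sum_sub_distrib, ← Finset.sum_mul, hw1, ← hm]
    ring
  have h := iidExp_sq_sum_of_centred (ι := ι) hw1 (fun a => f a - m) hc
  simp only [Finset.sum_sub_distrib, Finset.sum_const, Finset.card_univ, nsmul_eq_mul] at h
  rw [h]
  refine mul_le_mul_of_nonneg_left ?_ (Nat.cast_nonneg _)
  have : ∑ a, w a * (f a - m) ^ 2 = ∑ a, w a * f a ^ 2 - m ^ 2 := by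
    have e : ∀ a, w a * (f a - m) ^ 2 = w a * f a ^ 2 - 2 * m * (w a * f a) + m ^ 2 * w a :=
      fun a => by ring
    simp only [e, Finset.sum_add_distrib, Finset.sum_sub_distrib, ← Finset.mul_sum, hw1, ← hm]
    ring
  rw [this]
  nlinarith [sq_nonneg m]

open Classical in
/-- Chebyshev's inequality for a sum of independent terms. -/
lemma iidExp_indicator_deviation_le (hw : ∀ a, 0 ≤ w a) (hw1 : ∑ a, w a = 1) (f : α → ℝ)
    {t : ℝ} (ht : 0 < t) :
    iidExp w (fun c : ι → α =>
        if t ≤ |∑ i, f (c i) - Fintype.card ι * ∑ a, w a * f a| then 1 else 0)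
      ≤ Fintype.card ι * (∑ a, w a * f a ^ 2) / t ^ 2 := by
  rw [le_div_iff₀ (by positivity), mul_comm, ← iidExp_mul_left]
  refine (iidExp_mono hw fun c => ?_).trans (iidExp_sq_sum_sub_mean_le hw1 f)
  split_ifs with hc
  · rw [mul_one, ← sq_abs (_ - _)]
    gcongr
  · rw [mul_zero]
    positivity

/-- The outcome `c` avoids the null letters of `w`, and the empirical sums of all the statistics
`φ j` are within `t` of their means. -/
def IsTypical {κ : Type*} (w : α → ℝ) (φ : κ → α → ℝ) (t : ℝ) (c : ι → α) : Prop :=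
  (∀ i, 0 < w (c i)) ∧ ∀ j, |∑ i, φ j (c i) - Fintype.card ι * ∑ a, w a * φ j a| < t

open Classical in
/-- The weak law of large numbers, for finitely many statistics at once. -/
lemma iidExp_not_isTypical_le {κ : Type*} [Fintype κ] (hw : ∀ a, 0 ≤ w a) (hw1 : ∑ a, w a = 1)
    (φ : κ → α → ℝ) {t : ℝ} (ht : 0 < t) :
    iidExp w (fun c : ι → α => if IsTypical w φ t c then 0 else 1)
      ≤ Fintype.card ι * (∑ j, ∑ a, w a * φ j a ^ 2) / t ^ 2 := by
  calc _ ≤ iidExp w (fun c : ι → α => ∑ j,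
        if t ≤ |∑ i, φ j (c i) - Fintype.card ι * ∑ a, w a * φ j a| then 1 else 0) := by
        refine Finset.sum_le_sum fun c _ => ?_
        by_cases h0 : ∃ i, w (c i) = 0
        · obtain ⟨i, hi⟩ := h0
          simp [Finset.prod_eq_zero (f := fun i => w (c i)) (Finset.mem_univ i) hi]
        push Not at h0
        refine mul_le_mul_of_nonneg_left ?_ (Finset.prod_nonneg fun i _ => hw _)
        beta_reduce
        split_ifs with hc
        · exact Finset.sum_nonneg fun i _ => by positivity
        · have hj : ∃ j, t ≤ |∑ i, φ j (c i) - Fintype.card ι * ∑ a, w a * φ j a| := by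
            by_contra! hj
            exact hc ⟨fun i => lt_of_le_of_ne (hw _) (h0 i).symm, hj⟩
          obtain ⟨j, hj⟩ := hj
          refine le_trans (by simp [hj]) (Finset.single_le_sum
            (f := fun j => if t ≤ |∑ i, φ j (c i) - Fintype.card ι * ∑ a, w a * φ j a|
              then (1 : ℝ) else 0) (fun i _ => by positivity) (Finset.mem_univ j))
    _ ≤ ∑ j, Fintype.card ι * (∑ a, w a * φ j a ^ 2) / t ^ 2 := by
        rw [iidExp_sum]
        exact Finset.sum_le_sum fun j _ => iidExp_indicator_deviation_le hw hw1 (φ j) ht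
    _ = _ := by rw [Finset.mul_sum, Finset.sum_div]

lemma sq_iidExp_abs_le (hw : ∀ a, 0 ≤ w a) (hw1 : ∑ a, w a = 1) (F : (ι → α) → ℝ) :
    (iidExp w fun c => |F c|) ^ 2 ≤ iidExp w fun c => F c ^ 2 := by
  have hone : ∑ c : ι → α, ∏ i, w (c i) = 1 := by
    simp [sum_prod_apply (fun _ : ι => w), hw1]
  have := Real.pow_arith_mean_le_arith_mean_pow Finset.univ (fun c : ι → α => ∏ i, w (c i))
    (fun c => |F c|) (fun c _ => Finset.prod_nonneg fun i _ => hw _) hone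
    (fun c _ => abs_nonneg _) 2
  simpa [iidExp, sq_abs] using this

end iidExp

/-! ### One-shot hybrid coding -/

section coding

variable {ι S U Z Y : Type*} [Fintype ι] [DecidableEq ι] [Fintype S] [Fintype U] [Fintype Z]
  [Fintype Y]

open Classical in
/-- Soft covering: if the rate of a random codebook exceeds the information density `v u s / p s`,
then the average of `v` over the codewords is close to `p`. Only the part of the total variation
where the average falls short of `p` is needed. -/
lemma iidExp_covering_le [Nonempty ι] {pU : U → ℝ} (hpU : ∀ u, 0 ≤ pU u) (hpU1 : ∑ u, pU u = 1)
    {v : U → S → ℝ} (hv : ∀ u s, 0 ≤ v u s) {p : S → ℝ} (hp : ∀ s, 0 ≤ p s)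
    (hp1 : ∑ s, p s = 1) (hvp : ∀ s, ∑ u, pU u * v u s = p s) {l : ℝ} (hl : 0 ≤ l) :
    iidExp pU (fun c : ι → U => ∑ s, max (p s - (∑ m, v (c m) s) / Fintype.card ι) 0)
      ≤ (∑ s, ∑ u, pU u * v u s * if v u s ≤ l * p s then 0 else 1)
        + √(l / Fintype.card ι) := by
  have hM : (0 : ℝ) < Fintype.card ι := by exact_mod_cast Fintype.card_pos
  set M : ℝ := (Fintype.card ι : ℝ)
  have hroot : √(l / M) = ∑ s, p s * √(l / M) := by rw [← Finset.sum_mul, hp1, one_mul]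
  rw [iidExp_sum, hroot, ← Finset.sum_add_distrib]
  refine Finset.sum_le_sum fun s _ => ?_
  -- `t` is `v · s` truncated at `l * p s`, which makes its second moment small.
  set t : U → ℝ := fun u => if v u s ≤ l * p s then v u s else 0 with ht
  set Et : ℝ := ∑ u, pU u * t u with hEt
  set r : ℝ := ∑ u, pU u * v u s * if v u s ≤ l * p s then 0 else 1 with hr
  have hsplit : Et + r = p s := by
    rw [← hvp s, hEt, hr, ← Finset.sum_add_distrib]
    refine Finset.sum_congr rfl fun u _ => ?_
    simp only [ht]
    split_ifs <;> ring
  have ht0 : ∀ u, 0 ≤ t u := fun u => by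
    simp only [ht]
    split_ifs
    exacts [hv u s, le_rfl]
  have htv : ∀ u, t u ≤ v u s := fun u => by
    simp only [ht]
    split_ifs
    exacts [le_rfl, hv u s]
  have hr0 : 0 ≤ r := Finset.sum_nonneg fun u _ =>
    mul_nonneg (mul_nonneg (hpU u) (hv u s)) (by split_ifs <;> norm_num)
  have hsq : ∑ u, pU u * t u ^ 2 ≤ l * p s * p s := by
    have h1 : ∑ u, pU u * t u ^ 2 ≤ ∑ u, l * p s * (pU u * t u) := by
      refine Finset.sum_le_sum fun u _ => ?_
      have : t u ≤ l * p s := by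
        simp only [ht]
        split_ifs with h
        exacts [h, mul_nonneg hl (hp s)]
      have h2 := mul_le_mul_of_nonneg_left this (mul_nonneg (hpU u) (ht0 u))
      linarith [h2, show pU u * t u ^ 2 = pU u * t u * t u by ring]
    rw [← Finset.mul_sum] at h1
    exact h1.trans (mul_le_mul_of_nonneg_left (by linarith) (mul_nonneg hl (hp s)))
  have hdev : iidExp pU (fun c : ι → U => |∑ m, t (c m) - M * Et|) ≤ M * (p s * √(l / M)) := by
    refine abs_le_of_sq_le_sq' ?_ (by have := hp s; positivity) |>.2
    refine (sq_iidExp_abs_le hpU hpU1 _).trans ((iidExp_sq_sum_sub_mean_le hpU1 t).trans ?_)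
    rw [mul_pow, mul_pow, Real.sq_sqrt (by positivity)]
    calc M * ∑ u, pU u * t u ^ 2 ≤ M * (l * p s * p s) := by gcongr
      _ = _ := by field_simp
  calc iidExp pU (fun c : ι → U => max (p s - (∑ m, v (c m) s) / M) 0)
      ≤ iidExp pU (fun c : ι → U => r + M⁻¹ * |∑ m, t (c m) - M * Et|) := by
        refine iidExp_mono hpU fun c => max_le ?_ (by positivity)
        have h1 : (∑ m, t (c m)) / M ≤ (∑ m, v (c m) s) / M := by
          gcongr with m
          exact htv _
        have h2 : M⁻¹ * (M * Et - ∑ m, t (c m)) ≤ M⁻¹ * |∑ m, t (c m) - M * Et| := by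
          rw [abs_sub_comm]
          gcongr
          exact le_abs_self _
        have h3 : M⁻¹ * (M * Et - ∑ m, t (c m)) = Et - (∑ m, t (c m)) / M := by
          field_simp
        linarith
    _ = r + M⁻¹ * iidExp pU (fun c : ι → U => |∑ m, t (c m) - M * Et|) := by
        rw [iidExp_add, iidExp_const hpU1, iidExp_mul_left]
    _ ≤ r + p s * √(l / M) := by
        rw [add_le_add_iff_left, inv_mul_le_iff₀ hM]
        exact hdev

open Classical in
/-- Packing: the probability that a codeword other than the one sent passes the test `T` is at
most `card ι - 1` times that of an independent codeword passing it. -/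
lemma iidExp_packing_le {pU : U → ℝ} (hpU : ∀ u, 0 ≤ pU u) (hpU1 : ∑ u, pU u = 1)
    {Ω : Type*} [Fintype Ω] {V : U → Ω → ℝ} (hV : ∀ u ω, 0 ≤ V u ω) (T : U → Ω → Prop) (m : ι) :
    iidExp pU (fun c : ι → U =>
        ∑ ω, V (c m) ω * if ∃ m', m' ≠ m ∧ T (c m') ω then 1 else 0)
      ≤ ((Fintype.card ι : ℝ) - 1) *
        ∑ u, ∑ u', pU u * pU u' * ∑ ω, V u ω * if T u' ω then 1 else 0 := by
  have hcard : ((Finset.univ.erase m).card : ℝ) = (Fintype.card ι : ℝ) - 1 := by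
    rw [Finset.card_erase_of_mem (Finset.mem_univ m), Finset.card_univ,
      Nat.cast_sub (Fintype.card_pos_iff.2 ⟨m⟩), Nat.cast_one]
  calc _ ≤ iidExp pU (fun c : ι → U => ∑ m' ∈ Finset.univ.erase m,
        ∑ ω, V (c m) ω * if T (c m') ω then 1 else 0) := by
        refine iidExp_mono hpU fun c => ?_
        rw [Finset.sum_comm]
        refine Finset.sum_le_sum fun ω _ => ?_
        rw [← Finset.mul_sum]
        refine mul_le_mul_of_nonneg_left ?_ (hV _ _)
        split_ifs with h
        · obtain ⟨m', hm', hT⟩ := h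
          refine le_trans (by simp [hT]) (Finset.single_le_sum
            (f := fun m' => if T (c m') ω then (1 : ℝ) else 0)
            (fun i _ => by positivity) (Finset.mem_erase.2 ⟨hm', Finset.mem_univ m'⟩))
        · exact Finset.sum_nonneg fun i _ => by positivity
    _ = _ := by
        rw [iidExp_sum, ← hcard, ← nsmul_eq_mul, ← Finset.sum_const]
        refine Finset.sum_congr rfl fun m' hm' => ?_
        exact iidExp_coord₂ hpU1 (Finset.ne_of_mem_erase hm').symm
          (fun u u' => ∑ ω, V u ω * if T u' ω then 1 else 0)

open Classical in
/-- One-shot hybrid coding: for a source `p(s)`, a test channel `q(u | s)` and a channel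
`K(z, y | s, u)`, there are an encoder `e` and a decoder `D` such that, up to a small probability,
`D` recovers the codeword `e s` and the letters lie in the typical set `G`. Here `l` and `μ`
control the likelihood ratios `p(u | s) / p(u)` and `p(u, y) / (p(u) p(y))` on `G`, and `M` is the
size of the codebook. -/
theorem exists_hybrid_code {p : S → ℝ} (hp : p ∈ stdSimplex ℝ S)
    {q : S → U → ℝ} (hq : ∀ s, q s ∈ stdSimplex ℝ U)
    {K : S → U → Z → Y → ℝ} (hK : ∀ s u z y, 0 ≤ K s u z y)
    (hK1 : ∀ s u, ∑ z, ∑ y, K s u z y = 1)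
    {pU : U → ℝ} (hpU : ∀ u, ∑ s, p s * q s u = pU u)
    {rUY : U → Y → ℝ} (hrUY : ∀ u y, ∑ s, ∑ z, p s * q s u * K s u z y = rUY u y)
    {pY : Y → ℝ} (hpY : ∀ y, ∑ u, rUY u y = pY y)
    {l μ : ℝ} (hl : 0 ≤ l) (hμ : 0 < μ) {M : ℕ} (hM : 0 < M)
    (G : S → U → Z → Y → Prop) (hGl : ∀ s u z y, G s u z y → q s u ≤ l * pU u)
    (hGμ : ∀ s u z y, G s u z y → μ * (pU u * pY y) ≤ rUY u y) :
    ∃ (e : S → U) (D : Y → U),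
      ∑ s, ∑ z, ∑ y, p s * K s (e s) z y * (if D y = e s ∧ G s (e s) z y then 0 else 1)
        ≤ 2 * (∑ s, ∑ u, ∑ z, ∑ y, p s * q s u * K s u z y * if G s u z y then 0 else 1)
          + √(l / M) + (M - 1) / μ := by
  have : NeZero M := ⟨hM.ne'⟩
  have hMr : (0 : ℝ) < M := by exact_mod_cast hM
  have hp0 := hp.1
  have hq0 : ∀ s u, 0 ≤ q s u := fun s => (hq s).1
  have hpU0 : ∀ u, 0 ≤ pU u := fun u => by
    rw [← hpU]
    exact Finset.sum_nonneg fun s _ => mul_nonneg (hp0 s) (hq0 s u)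
  have hpU1 : ∑ u, pU u = 1 := by
    simp only [← hpU]
    rw [Finset.sum_comm]
    simp only [← Finset.mul_sum, (hq _).2, mul_one, hp.2]
  have hr0 : ∀ u y, 0 ≤ rUY u y := fun u y => by
    rw [← hrUY]
    exact Finset.sum_nonneg fun s _ => Finset.sum_nonneg fun z _ =>
      mul_nonneg (mul_nonneg (hp0 s) (hq0 s u)) (hK s u z y)
  -- `v u s = p(s | u)`; if `pU u = 0` it is the junk value `0`, which is harmless by `hpv`.
  set v : U → S → ℝ := fun u s => p s * q s u / pU u with hv
  have hv0 : ∀ u s, 0 ≤ v u s := fun u s =>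
    div_nonneg (mul_nonneg (hp0 s) (hq0 s u)) (hpU0 u)
  have hpv : ∀ u s, pU u * v u s = p s * q s u := by
    intro u s
    rcases eq_or_ne (pU u) 0 with h | h
    · have h2 := (Finset.sum_eq_zero_iff_of_nonneg
        (fun s _ => mul_nonneg (hp0 s) (hq0 s u))).1 ((hpU u).trans h) s (Finset.mem_univ s)
      rw [h, zero_mul, h2]
    · rw [hv]
      field_simp
  set T : U → Y → Prop := fun u y => μ * (pU u * pY y) ≤ rUY u y with hT
  -- The decoder for the codebook `c` returns the index of some codeword that passes the test `T`.
  have hdec : ∀ (c : Fin M → U) (y : Y), ∃ m, (∃ m', T (c m') y) → T (c m) y := by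
    intro c y
    by_cases h : ∃ m', T (c m') y
    · exact ⟨h.choose, fun _ => h.choose_spec⟩
    · exact ⟨0, fun h' => absurd h' h⟩
  choose dec hdec using hdec
  -- Probability of failure given the codebook, the index sent and the source word.
  set b : (Fin M → U) → Fin M → S → ℝ := fun c m s => ∑ z, ∑ y, K s (c m) z y *
    (if dec c y = m ∧ G s (c m) z y then 0 else 1) with hb
  have hb0 : ∀ c m s, 0 ≤ b c m s := fun c m s => Finset.sum_nonneg fun z _ =>
    Finset.sum_nonneg fun y _ => mul_nonneg (hK _ _ _ _) (by split_ifs <;> norm_num)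
  have hb1 : ∀ c m s, b c m s ≤ 1 := by
    intro c m s
    rw [← hK1 s (c m)]
    refine Finset.sum_le_sum fun z _ => Finset.sum_le_sum fun y _ => ?_
    exact mul_le_of_le_one_right (hK _ _ _ _) (by split_ifs <;> norm_num)
  -- The encoder minimizes the conditional probability of failure.
  have henc : ∀ (c : Fin M → U) (s : S), ∃ m, ∀ m', b c m s ≤ b c m' s := fun c s =>
    Finite.exists_min fun m => b c m s
  choose enc henc using henc
  -- Comparison with the ideal law, in which the index is uniform and `s` has law `v (c m)`.
  have hobj : ∀ c, ∑ s, p s * b c (enc c s) s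
      ≤ (∑ s, max (p s - (∑ m, v (c m) s) / Fintype.card (Fin M)) 0)
        + (M : ℝ)⁻¹ * ∑ m, ∑ s, v (c m) s * b c m s := by
    intro c
    rw [Finset.sum_comm, Finset.mul_sum, ← Finset.sum_add_distrib, Fintype.card_fin]
    refine Finset.sum_le_sum fun s _ => ?_
    set β := b c (enc c s) s with hβ
    have h1 : (∑ m, v (c m) s) * β ≤ ∑ m, v (c m) s * b c m s := by
      rw [Finset.sum_mul]
      exact Finset.sum_le_sum fun m _ => mul_le_mul_of_nonneg_left (henc c s m) (hv0 _ _)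
    have h2 := mul_le_mul_of_nonneg_left h1 (inv_nonneg.2 hMr.le)
    have h3 : (p s - (∑ m, v (c m) s) / M) * β ≤ max (p s - (∑ m, v (c m) s) / M) 0 :=
      (mul_le_mul_of_nonneg_right (le_max_left _ 0) (hb0 _ _ _)).trans
        (mul_le_of_le_one_right (le_max_right _ _) (hb1 _ _ _))
    have h4 : (p s - (∑ m, v (c m) s) / M) * β
        = p s * β - (M : ℝ)⁻¹ * ((∑ m, v (c m) s) * β) := by ring
    linarith
  set E := ∑ s, ∑ u, ∑ z, ∑ y, p s * q s u * K s u z y * (if G s u z y then (0 : ℝ) else 1)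
    with hE
  have hcov := iidExp_covering_le (ι := Fin M) hpU0 hpU1 hv0 hp0 hp.2
    (fun s => by simp only [hpv, ← Finset.mul_sum, (hq s).2, mul_one]) hl
  have hcovE : (∑ s, ∑ u, pU u * v u s * if v u s ≤ l * p s then (0 : ℝ) else 1) ≤ E := by
    refine Finset.sum_le_sum fun s _ => Finset.sum_le_sum fun u _ => ?_
    rw [hpv]
    have hpq := mul_nonneg (hp0 s) (hq0 s u)
    split_ifs with h
    · rw [mul_zero]
      exact Finset.sum_nonneg fun z _ => Finset.sum_nonneg fun y _ =>
        mul_nonneg (mul_nonneg hpq (hK _ _ _ _)) (by split_ifs <;> norm_num)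
    · have hnG : ∀ z y, ¬ G s u z y := fun z y hG => h <| by
        refine div_le_of_le_mul₀ (hpU0 u) (mul_nonneg hl (hp0 s)) ?_
        have := mul_le_mul_of_nonneg_left (hGl s u z y hG) (hp0 s)
        linarith
      simp only [hnG, if_false, mul_one, ← Finset.mul_sum, hK1, le_refl]
  -- Failure for index `m`: atypicality, or a wrong codeword passing the test.
  have hbb : ∀ c m s, b c m s ≤ (∑ z, ∑ y, K s (c m) z y * (if G s (c m) z y then (0 : ℝ) else 1))
      + ∑ z, ∑ y, K s (c m) z y * (if ∃ m', m' ≠ m ∧ T (c m') y then 1 else 0) := by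
    intro c m s
    simp only [hb, ← Finset.sum_add_distrib, ← mul_add]
    refine Finset.sum_le_sum fun z _ => Finset.sum_le_sum fun y _ =>
      mul_le_mul_of_nonneg_left ?_ (hK _ _ _ _)
    by_cases hG : G s (c m) z y
    · by_cases hd : dec c y = m
      · simp only [hd, hG, and_self, if_true, zero_add]
        split_ifs <;> norm_num
      · have : ∃ m', m' ≠ m ∧ T (c m') y := ⟨dec c y, hd, hdec c y ⟨m, hGμ s _ z y hG⟩⟩
        simp [hd, hG, this]
    · simp only [hG, and_false, if_false]
      have : (0 : ℝ) ≤ if ∃ m', m' ≠ m ∧ T (c m') y then 1 else 0 := by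
        split_ifs <;> norm_num
      linarith
  have hfail : ∀ m, iidExp pU (fun c => ∑ s, v (c m) s * b c m s) ≤ E + (M - 1) / μ := by
    intro m
    have hpack := iidExp_packing_le (ι := Fin M) hpU0 hpU1
      (V := fun u (ω : S × Z × Y) => v u ω.1 * K ω.1 u ω.2.1 ω.2.2)
      (fun u ω => mul_nonneg (hv0 _ _) (hK _ _ _ _)) (fun u ω => T u ω.2.2) m
    have hleft := iidExp_coord (ι := Fin M) hpU1 m (fun u => ∑ s, v u s *
      ∑ z, ∑ y, K s u z y * (if G s u z y then (0 : ℝ) else 1))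
    have hleftE : ∑ u, pU u * ∑ s, v u s *
        ∑ z, ∑ y, K s u z y * (if G s u z y then (0 : ℝ) else 1) = E := by
      rw [hE, Finset.sum_comm]
      refine Finset.sum_congr rfl fun u _ => ?_
      rw [Finset.mul_sum]
      refine Finset.sum_congr rfl fun s _ => ?_
      rw [← mul_assoc, hpv]
      simp only [Finset.mul_sum, mul_assoc]
    have hright : ∑ u, ∑ u', pU u * pU u' * ∑ ω : S × Z × Y,
        v u ω.1 * K ω.1 u ω.2.1 ω.2.2 * (if T u' ω.2.2 then (1 : ℝ) else 0) ≤ 1 / μ := by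
      have h1 : ∀ u u', pU u * pU u' * ∑ ω : S × Z × Y,
          v u ω.1 * K ω.1 u ω.2.1 ω.2.2 * (if T u' ω.2.2 then (1 : ℝ) else 0)
          = ∑ y, pU u' * rUY u y * (if T u' y then 1 else 0) := by
        intro u u'
        simp only [Fintype.sum_prod_type, ← hrUY, Finset.mul_sum, Finset.sum_mul]
        rw [Finset.sum_congr rfl fun s _ => Finset.sum_comm, Finset.sum_comm]
        refine Finset.sum_congr rfl fun y _ => Finset.sum_congr rfl fun s _ =>
          Finset.sum_congr rfl fun z _ => ?_
        rw [← hpv]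
        ring
      simp only [h1]
      rw [Finset.sum_comm]
      have h2 : ∀ u' y, ∑ u, pU u' * rUY u y * (if T u' y then (1 : ℝ) else 0)
          ≤ 1 / μ * rUY u' y := by
        intro u' y
        rw [← Finset.sum_mul, ← Finset.mul_sum, hpY]
        split_ifs with h
        · rw [mul_one, one_div, ← div_eq_inv_mul, le_div_iff₀ hμ, mul_comm]
          exact h
        · rw [mul_zero]
          exact mul_nonneg (by positivity) (hr0 _ _)
      have hr1 : ∑ u, ∑ y, rUY u y = 1 := by
        rw [← hpU1]
        refine Finset.sum_congr rfl fun u _ => ?_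
        simp only [← hrUY, ← hpU]
        rw [Finset.sum_comm]
        refine Finset.sum_congr rfl fun s _ => ?_
        rw [Finset.sum_comm]
        simp only [← Finset.mul_sum, hK1, mul_one]
      calc _ = ∑ u', ∑ y, ∑ u, pU u' * rUY u y * (if T u' y then (1 : ℝ) else 0) :=
            Finset.sum_congr rfl fun u' _ => Finset.sum_comm
        _ ≤ ∑ u', ∑ y, 1 / μ * rUY u' y :=
            Finset.sum_le_sum fun u' _ => Finset.sum_le_sum fun y _ => h2 u' y
        _ = 1 / μ := by simp only [← Finset.mul_sum, hr1, mul_one]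
    have hM1 : (0 : ℝ) ≤ M - 1 := by
      have : (1 : ℝ) ≤ M := by exact_mod_cast hM
      linarith
    calc _ ≤ iidExp pU (fun c : Fin M → U => (∑ s, v (c m) s *
            ∑ z, ∑ y, K s (c m) z y * (if G s (c m) z y then (0 : ℝ) else 1))
          + ∑ ω : S × Z × Y, v (c m) ω.1 * K ω.1 (c m) ω.2.1 ω.2.2 *
            if ∃ m', m' ≠ m ∧ T (c m') ω.2.2 then 1 else 0) := by
          refine iidExp_mono hpU0 fun c => ?_
          rw [Fintype.sum_prod_type]
          simp only [Fintype.sum_prod_type, mul_assoc, ← Finset.mul_sum]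
          rw [← Finset.sum_add_distrib]
          refine Finset.sum_le_sum fun s _ => ?_
          rw [← mul_add]
          exact mul_le_mul_of_nonneg_left (hbb c m s) (hv0 _ _)
      _ ≤ E + (M - 1) * (1 / μ) := by
          rw [iidExp_add, hleft, hleftE]
          refine add_le_add le_rfl ((le_of_eq (by congr!)).trans (hpack.trans ?_))
          rw [Fintype.card_fin]
          exact mul_le_mul_of_nonneg_left hright hM1
      _ = _ := by ring
  obtain ⟨c, hc⟩ := exists_le_iidExp (ι := Fin M) hpU0 hpU1
    (fun c => ∑ s, p s * b c (enc c s) s)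
  refine ⟨fun s => c (enc c s), fun y => c (dec c y), ?_⟩
  calc _ ≤ ∑ s, p s * b c (enc c s) s := by
        refine Finset.sum_le_sum fun s _ => ?_
        simp only [hb, Finset.mul_sum]
        refine Finset.sum_le_sum fun z _ => Finset.sum_le_sum fun y _ => ?_
        rw [mul_assoc]
        refine mul_le_mul_of_nonneg_left (mul_le_mul_of_nonneg_left ?_ (hK _ _ _ _)) (hp0 s)
        by_cases hd : dec c y = enc c s
        · simp [hd]
        · simp only [hd, false_and, if_false]
          split_ifs <;> norm_num
    _ ≤ _ := hc.trans (iidExp_mono hpU0 hobj)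
    _ ≤ (E + √(l / M)) + (M : ℝ)⁻¹ * ∑ _m : Fin M, (E + (M - 1) / μ) := by
        rw [iidExp_add, iidExp_mul_left,
          iidExp_sum Finset.univ fun m c => ∑ s, v (c m) s * b c m s]
        refine add_le_add ?_ ?_
        · simp only [Fintype.card_fin] at hcov ⊢
          linarith
        · exact mul_le_mul_of_nonneg_left (Finset.sum_le_sum fun m _ => hfail m) (by positivity)
    _ = _ := by
        rw [Finset.sum_const, Finset.card_univ, Fintype.card_fin, nsmul_eq_mul]
        field_simp
        ring

end coding

/-! ### Typical blocks and codes for product alphabets -/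

lemma sum_pi_prod {ι A B : Type*} [Fintype ι] [DecidableEq ι] [Fintype A] [Fintype B]
    (H : (ι → A) → (ι → B) → ℝ) :
    ∑ a, ∑ b, H a b = ∑ c : ι → A × B, H (fun i => (c i).1) (fun i => (c i).2) := by
  rw [← Fintype.sum_prod_type']
  exact (Fintype.sum_equiv (Equiv.arrowProdEquivProdArrow ι (fun _ => A) (fun _ => B)) _ _
    fun c => rfl).symm

lemma sum_pi_prod₄ {ι A B A' B' : Type*} [Fintype ι] [DecidableEq ι] [Fintype A] [Fintype B]
    [Fintype A'] [Fintype B'] (H : (ι → A) → (ι → B) → (ι → A') → (ι → B') → ℝ) :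
    ∑ a, ∑ b, ∑ a', ∑ b', H a b a' b'
      = ∑ c : ι → A × B × A' × B', H (fun i => (c i).1) (fun i => (c i).2.1)
          (fun i => (c i).2.2.1) (fun i => (c i).2.2.2) := by
  have h1 : ∀ a b, ∑ a', ∑ b', H a b a' b'
      = ∑ c : ι → A' × B', H a b (fun i => (c i).1) (fun i => (c i).2) := fun a b =>
    sum_pi_prod (H a b)
  have h2 : ∀ a, ∑ b, ∑ c : ι → A' × B', H a b (fun i => (c i).1) (fun i => (c i).2)
      = ∑ c : ι → B × A' × B', H a (fun i => (c i).1) (fun i => (c i).2.1)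
          (fun i => (c i).2.2) := fun a =>
    sum_pi_prod fun b (c : ι → A' × B') => H a b (fun i => (c i).1) (fun i => (c i).2)
  simp only [h1, h2]
  exact sum_pi_prod fun a (c : ι → B × A' × B') => H a (fun i => (c i).1)
    (fun i => (c i).2.1) (fun i => (c i).2.2)

/-- A product distribution is a distribution. -/
lemma prod_mem_stdSimplex {ι A : Type*} [Fintype ι] [DecidableEq ι] [Fintype A]
    {w : ι → A → ℝ} (hw : ∀ i, w i ∈ stdSimplex ℝ A) :
    (fun c : ι → A => ∏ i, w i (c i)) ∈ stdSimplex ℝ (ι → A) :=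
  ⟨fun c => Finset.prod_nonneg fun i _ => (hw i).1 _, by simp [sum_prod_apply w, (hw _).2]⟩

lemma prod_le_exp_mul_prod {ι : Type*} [Fintype ι] {a b : ι → ℝ} (ha : ∀ i, 0 < a i)
    (hb : ∀ i, 0 < b i) {t : ℝ} (h : ∑ i, Real.log (a i / b i) ≤ t) :
    ∏ i, a i ≤ Real.exp t * ∏ i, b i := by
  have h1 : ∏ i, a i / b i ≤ Real.exp t := by
    rw [← Real.log_le_iff_le_exp (Finset.prod_pos fun i _ => div_pos (ha i) (hb i)),
      Real.log_prod fun i _ => (div_pos (ha i) (hb i)).ne']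
    exact h
  rwa [Finset.prod_div_distrib, div_le_iff₀ (Finset.prod_pos fun i _ => hb i)] at h1

namespace HelperProblem.HybridChoice

variable {S₁ S₂ X Y R U : Type*} [Fintype S₁] [Fintype S₂] [Fintype X] [Fintype Y] [Fintype R]
  [Fintype U] {P : HelperProblem S₁ S₂ X Y R}

/-- The law of `U`. -/
noncomputable def lawU (h : P.HybridChoice U) (u : U) : ℝ := ∑ s₂, P.p₂ s₂ * h.q s₂ u

/-- The joint law of `(U, Y)`. -/
noncomputable def lawUY (h : P.HybridChoice U) (u : U) (y : Y) : ℝ :=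
  ∑ s₁, ∑ s₂, h.law s₁ s₂ u y

/-- The law of `Y`. -/
noncomputable def lawY (h : P.HybridChoice U) (y : Y) : ℝ := ∑ u, h.lawUY u y

/-- The joint law of one letter `(S₂, U, S₁, Y)`, as a function on the product alphabet. -/
noncomputable def letterLaw (h : P.HybridChoice U) (ω : S₂ × U × S₁ × Y) : ℝ :=
  h.law ω.2.2.1 ω.1 ω.2.1 ω.2.2.2

/-- The per-letter statistics which a typical block has to reproduce: the information densities
of `(U, S₂)` and `(U, Y)`, the cost and the distortion. -/
noncomputable def stat (h : P.HybridChoice U) : Fin 4 → S₂ × U × S₁ × Y → ℝ :=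
  ![fun ω => Real.log (h.q ω.1 ω.2.1 / h.lawU ω.2.1),
    fun ω => Real.log (h.lawUY ω.2.1 ω.2.2.2 / (h.lawU ω.2.1 * h.lawY ω.2.2.2)),
    fun ω => P.ρ (h.f ω.1 ω.2.1),
    fun ω => P.d ω.2.2.1 (h.g ω.2.1 ω.2.2.2)]

variable (h : P.HybridChoice U)

lemma law_nonneg (s₁ : S₁) (s₂ : S₂) (u : U) (y : Y) : 0 ≤ h.law s₁ s₂ u y :=
  mul_nonneg (mul_nonneg (mul_nonneg (P.p₁_mem.1 _) (P.p₂_mem.1 _)) ((h.q_mem _).1 _))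
    ((P.W_mem _ _ _).1 _)

lemma lawUY_nonneg (u : U) (y : Y) : 0 ≤ h.lawUY u y :=
  Finset.sum_nonneg fun _ _ => Finset.sum_nonneg fun _ _ => h.law_nonneg _ _ _ _

lemma sum_sum_law (s₂ : S₂) (u : U) : ∑ s₁, ∑ y, h.law s₁ s₂ u y = P.p₂ s₂ * h.q s₂ u := by
  simp only [law, ← Finset.mul_sum, (P.W_mem _ _ _).2, mul_one, ← Finset.sum_mul, P.p₁_mem.2,
    one_mul]

lemma sum_lawUY (u : U) : ∑ y, h.lawUY u y = h.lawU u := by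
  simp only [lawUY, lawU, ← sum_sum_law]
  calc _ = ∑ s₁, ∑ s₂, ∑ y, h.law s₁ s₂ u y := by
        rw [Finset.sum_comm]
        exact Finset.sum_congr rfl fun s₁ _ => Finset.sum_comm
    _ = _ := Finset.sum_comm

lemma letterLaw_nonneg (ω : S₂ × U × S₁ × Y) : 0 ≤ h.letterLaw ω := h.law_nonneg _ _ _ _

lemma sum_letterLaw : ∑ ω, h.letterLaw ω = 1 := by
  simp only [Fintype.sum_prod_type, letterLaw, sum_sum_law, ← Finset.mul_sum, (h.q_mem _).2,
    mul_one, P.p₂_mem.2]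

lemma mean_stat_zero : ∑ ω, h.letterLaw ω * h.stat 0 ω = h.infoUS := by
  simp only [Fintype.sum_prod_type, letterLaw, stat, Matrix.cons_val_zero, ← Finset.sum_mul,
    sum_sum_law]
  rw [infoUS, mutualInfo, Finset.sum_comm]
  refine Finset.sum_congr rfl fun u _ => Finset.sum_congr rfl fun s₂ _ => ?_
  rw [← Finset.mul_sum, (h.q_mem _).2, mul_one, ← lawU]
  rcases eq_or_ne (P.p₂ s₂) 0 with h0 | h0
  · simp [h0]
  · rw [mul_comm (h.lawU u), mul_div_mul_left _ _ h0]

lemma mean_stat_one : ∑ ω, h.letterLaw ω * h.stat 1 ω = h.infoUY := by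
  simp only [Fintype.sum_prod_type, letterLaw, stat, Matrix.cons_val_one, Matrix.cons_val_zero]
  rw [infoUY, mutualInfo, Finset.sum_comm]
  refine Finset.sum_congr rfl fun u _ => ?_
  rw [Finset.sum_congr rfl fun s₂ _ => Finset.sum_comm, Finset.sum_comm]
  refine Finset.sum_congr rfl fun y _ => ?_
  rw [Finset.sum_comm]
  simp only [← Finset.sum_mul]
  change h.lawUY u y * _ = h.lawUY u y * Real.log (h.lawUY u y / ((∑ b, h.lawUY u b) * h.lawY y))
  rw [sum_lawUY]

lemma mean_stat_two : ∑ ω, h.letterLaw ω * h.stat 2 ω = h.cost := by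
  simp [Fintype.sum_prod_type, letterLaw, stat, ← Finset.sum_mul, sum_sum_law, cost]

lemma mean_stat_three : ∑ ω, h.letterLaw ω * h.stat 3 ω = h.distortion := by
  simp only [Fintype.sum_prod_type, letterLaw, distortion]
  change ∑ s₂, ∑ u, ∑ s₁, ∑ y, h.law s₁ s₂ u y * P.d s₁ (h.g u y) = _
  rw [Finset.sum_congr rfl fun s₂ _ => Finset.sum_comm, Finset.sum_comm]

/-- The sum of the second moments of the statistics, the constant in the law of large numbers. -/
noncomputable def statMoment : ℝ := ∑ j, ∑ ω, h.letterLaw ω * h.stat j ω ^ 2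

/-- Conditional law of `(S₁ⁿ, Yⁿ)` given `S₂ⁿ` and `Uⁿ`. -/
noncomputable def blockKernel (h : P.HybridChoice U) {n : ℕ} (s₂ : Fin n → S₂) (u : Fin n → U)
    (s₁ : Fin n → S₁) (y : Fin n → Y) : ℝ :=
  (∏ i, P.p₁ (s₁ i)) * ∏ i, P.W (h.f (s₂ i) (u i)) (s₁ i) (s₂ i) (y i)

lemma blockKernel_nonneg {n : ℕ} (s₂ : Fin n → S₂) (u : Fin n → U)
    (s₁ : Fin n → S₁) (y : Fin n → Y) : 0 ≤ h.blockKernel s₂ u s₁ y :=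
  mul_nonneg (Finset.prod_nonneg fun _ _ => P.p₁_mem.1 _)
    (Finset.prod_nonneg fun _ _ => (P.W_mem _ _ _).1 _)

lemma sum_blockKernel {n : ℕ} (s₂ : Fin n → S₂) (u : Fin n → U) :
    ∑ s₁, ∑ y, h.blockKernel s₂ u s₁ y = 1 := by
  have h1 : ∀ s₁ : Fin n → S₁, ∑ y : Fin n → Y, ∏ i, P.W (h.f (s₂ i) (u i)) (s₁ i) (s₂ i) (y i)
      = 1 := fun s₁ => (prod_mem_stdSimplex fun i => P.W_mem _ _ _).2
  simp only [blockKernel, ← Finset.mul_sum, h1, mul_one]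
  exact (prod_mem_stdSimplex fun i => P.p₁_mem).2

lemma prod_mul_blockKernel {n : ℕ} (s₂ : Fin n → S₂) (u : Fin n → U) (s₁ : Fin n → S₁)
    (y : Fin n → Y) :
    (∏ i, P.p₂ (s₂ i)) * (∏ i, h.q (s₂ i) (u i)) * h.blockKernel s₂ u s₁ y
      = ∏ i, h.letterLaw (s₂ i, u i, s₁ i, y i) := by
  simp only [letterLaw, law, blockKernel, Finset.prod_mul_distrib]
  ring

lemma sum_prod_letterLaw {n : ℕ} (u : Fin n → U) (y : Fin n → Y) :
    ∑ s₂ : Fin n → S₂, ∑ s₁ : Fin n → S₁, ∏ i, h.letterLaw (s₂ i, u i, s₁ i, y i)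
      = ∏ i, h.lawUY (u i) (y i) := by
  rw [sum_pi_prod, sum_prod_apply fun i (ω : S₂ × S₁) => h.letterLaw (ω.1, u i, ω.2, y i)]
  refine Finset.prod_congr rfl fun i _ => ?_
  rw [Fintype.sum_prod_type, Finset.sum_comm]
  rfl

/-- The block `(s₂, u, s₁, y)` is typical: its letters have positive probability and the empirical
means of the four statistics `HybridChoice.stat` are within `δ` of their expectations. -/
def IsTypicalBlock (h : P.HybridChoice U) (δ : ℝ) {n : ℕ} (s₂ : Fin n → S₂) (u : Fin n → U)
    (s₁ : Fin n → S₁) (y : Fin n → Y) : Prop :=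
  IsTypical h.letterLaw h.stat (n * δ) fun i => (s₂ i, u i, s₁ i, y i)

lemma pos_of_letterLaw_pos {s₂ : S₂} {u : U} {s₁ : S₁} {y : Y}
    (hpos : 0 < h.letterLaw (s₂, u, s₁, y)) :
    0 < h.q s₂ u ∧ 0 < h.lawU u ∧ 0 < h.lawUY u y ∧ 0 < h.lawY y := by
  have hq : 0 < h.q s₂ u := by
    refine lt_of_le_of_ne ((h.q_mem _).1 _) fun h0 => hpos.ne' ?_
    simp [letterLaw, law, ← h0]
  have hUY : 0 < h.lawUY u y := by
    refine lt_of_lt_of_le hpos ?_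
    refine le_trans ?_ (Finset.single_le_sum (f := fun s₁ => ∑ s₂, h.law s₁ s₂ u y)
      (fun s₁ _ => Finset.sum_nonneg fun s₂ _ => h.law_nonneg _ _ _ _) (Finset.mem_univ s₁))
    exact Finset.single_le_sum (f := fun s₂ => h.law s₁ s₂ u y)
      (fun s₂ _ => h.law_nonneg _ _ _ _) (Finset.mem_univ s₂)
  refine ⟨hq, ?_, hUY, ?_⟩
  · rw [← sum_lawUY]
    exact hUY.trans_le (Finset.single_le_sum (f := fun y => h.lawUY u y)
      (fun y _ => h.lawUY_nonneg _ _) (Finset.mem_univ y))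
  · exact hUY.trans_le (Finset.single_le_sum (f := fun u => h.lawUY u y)
      (fun y _ => h.lawUY_nonneg _ _) (Finset.mem_univ u))

section typical

variable {h} {δ : ℝ} {n : ℕ} {s₂ : Fin n → S₂} {u : Fin n → U} {s₁ : Fin n → S₁} {y : Fin n → Y}

/-- On typical blocks the information density of `(U, S₂)` is at most `n (I(U;S₂) + δ)`. -/
lemma IsTypicalBlock.prod_q_le (hG : h.IsTypicalBlock δ s₂ u s₁ y) :
    ∏ i, h.q (s₂ i) (u i) ≤ Real.exp (n * (h.infoUS + δ)) * ∏ i, h.lawU (u i) := by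
  refine prod_le_exp_mul_prod (fun i => (h.pos_of_letterLaw_pos (hG.1 i)).1)
    (fun i => (h.pos_of_letterLaw_pos (hG.1 i)).2.1) ?_
  have h0 := (abs_lt.1 (hG.2 0)).2
  rw [mean_stat_zero, Fintype.card_fin] at h0
  simp only [stat, Matrix.cons_val_zero] at h0
  linarith

/-- On typical blocks the information density of `(U, Y)` is at least `n (I(U;Y) - δ)`. -/
lemma IsTypicalBlock.le_prod_lawUY (hG : h.IsTypicalBlock δ s₂ u s₁ y) :
    Real.exp (n * (h.infoUY - δ)) * ((∏ i, h.lawU (u i)) * ∏ i, h.lawY (y i))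
      ≤ ∏ i, h.lawUY (u i) (y i) := by
  have hpos := fun i => h.pos_of_letterLaw_pos (hG.1 i)
  rw [← Finset.prod_mul_distrib]
  have h1 := prod_le_exp_mul_prod (a := fun i => h.lawU (u i) * h.lawY (y i))
    (b := fun i => h.lawUY (u i) (y i)) (t := -(n * (h.infoUY - δ)))
    (fun i => mul_pos (hpos i).2.1 (hpos i).2.2.2) (fun i => (hpos i).2.2.1) ?_
  · rw [Real.exp_neg, inv_mul_eq_div, le_div_iff₀ (Real.exp_pos _)] at h1
    linarith
  · have h0 := (abs_lt.1 (hG.2 1)).1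
    rw [mean_stat_one, Fintype.card_fin] at h0
    simp only [stat, Matrix.cons_val_one, Matrix.cons_val_zero] at h0
    have h2 : ∑ i, Real.log (h.lawU (u i) * h.lawY (y i) / h.lawUY (u i) (y i))
        = -∑ i, Real.log (h.lawUY (u i) (y i) / (h.lawU (u i) * h.lawY (y i))) := by
      rw [← Finset.sum_neg_distrib]
      refine Finset.sum_congr rfl fun i _ => ?_
      rw [← Real.log_inv, inv_div]
    linarith

lemma IsTypicalBlock.cost_le (hn : 0 < n) (hG : h.IsTypicalBlock δ s₂ u s₁ y) :
    (∑ i, P.ρ (h.f (s₂ i) (u i))) / n ≤ h.cost + δ := by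
  have h0 := (abs_lt.1 (hG.2 2)).2
  rw [mean_stat_two, Fintype.card_fin] at h0
  rw [div_le_iff₀ (by exact_mod_cast hn)]
  change ∑ i, P.ρ (h.f (s₂ i) (u i)) - _ < _ at h0
  linarith

lemma IsTypicalBlock.distortion_le (hn : 0 < n) (hG : h.IsTypicalBlock δ s₂ u s₁ y) :
    (∑ i, P.d (s₁ i) (h.g (u i) (y i))) / n ≤ h.distortion + δ := by
  have h0 := (abs_lt.1 (hG.2 3)).2
  rw [mean_stat_three, Fintype.card_fin] at h0
  rw [div_le_iff₀ (by exact_mod_cast hn)]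
  change ∑ i, P.d (s₁ i) (h.g (u i) (y i)) - _ < _ at h0
  linarith

end typical

open Classical in
/-- Blocks drawn from the ideal law are typical with high probability. -/
lemma sum_not_isTypicalBlock_le {δ : ℝ} (hδ : 0 < δ) {n : ℕ} (hn : 0 < n) :
    ∑ s₂ : Fin n → S₂, ∑ u : Fin n → U, ∑ s₁ : Fin n → S₁, ∑ y : Fin n → Y,
        (∏ i, P.p₂ (s₂ i)) * (∏ i, h.q (s₂ i) (u i)) * h.blockKernel s₂ u s₁ y *
          (if h.IsTypicalBlock δ s₂ u s₁ y then 0 else 1)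
      ≤ h.statMoment / δ ^ 2 / n := by
  have hn' : (0 : ℝ) < n := by exact_mod_cast hn
  have h1 := iidExp_not_isTypical_le (ι := Fin n) h.letterLaw_nonneg h.sum_letterLaw h.stat
    (t := n * δ) (by positivity)
  rw [Fintype.card_fin, ← statMoment] at h1
  simp only [prod_mul_blockKernel]
  rw [sum_pi_prod₄ fun s₂ u s₁ y => (∏ i, h.letterLaw (s₂ i, u i, s₁ i, y i)) *
    (if h.IsTypicalBlock δ s₂ u s₁ y then (0 : ℝ) else 1)]
  refine h1.trans (le_of_eq ?_)
  field_simp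

open Classical in
/-- Block codes with small failure probability. The rate `I(U;S₂) + 2δ` of the codebook leaves
a margin `δ` to the thresholds `I(U;S₂) + δ` and `I(U;Y) - δ` on both sides. -/
lemma exists_block_code {δ : ℝ} (hδ : 0 < δ) (hI : h.infoUS + 4 * δ ≤ h.infoUY) {n : ℕ}
    (hn : 0 < n) :
    ∃ (e : (Fin n → S₂) → (Fin n → U)) (D : (Fin n → Y) → (Fin n → U)),
      ∑ s₂, ∑ s₁, ∑ y, (∏ i, P.p₂ (s₂ i)) * h.blockKernel s₂ (e s₂) s₁ y *
          (if D y = e s₂ ∧ h.IsTypicalBlock δ s₂ (e s₂) s₁ y then 0 else 1)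
        ≤ 2 * (h.statMoment / δ ^ 2 / n) + √(Real.exp (-(n * δ))) + Real.exp (-(n * δ)) := by
  set M : ℕ := ⌈Real.exp (n * (h.infoUS + 2 * δ))⌉₊ with hM
  have hM0 : 0 < M := Nat.ceil_pos.2 (Real.exp_pos _)
  have hMge : Real.exp (n * (h.infoUS + 2 * δ)) ≤ M := Nat.le_ceil _
  have hMlt : (M : ℝ) - 1 ≤ Real.exp (n * (h.infoUS + 2 * δ)) := by
    have := Nat.ceil_lt_add_one (Real.exp_pos (n * (h.infoUS + 2 * δ))).le
    rw [← hM] at this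
    linarith
  obtain ⟨e, D, hD⟩ := exists_hybrid_code
    (prod_mem_stdSimplex fun _ : Fin n => P.p₂_mem)
    (q := fun s₂ u => ∏ i, h.q (s₂ i) (u i))
    (fun s₂ => prod_mem_stdSimplex fun i => h.q_mem (s₂ i))
    (K := fun s₂ u s₁ y => h.blockKernel s₂ u s₁ y)
    (fun s₂ u s₁ y => h.blockKernel_nonneg s₂ u s₁ y)
    (fun s₂ u => h.sum_blockKernel s₂ u)
    (pU := fun u => ∏ i, h.lawU (u i))
    (fun u => by
      simp only [← Finset.prod_mul_distrib]
      exact sum_prod_apply fun i s₂ => P.p₂ s₂ * h.q s₂ (u i))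
    (rUY := fun u y => ∏ i, h.lawUY (u i) (y i))
    (fun u y => by
      simp only [prod_mul_blockKernel]
      exact h.sum_prod_letterLaw u y)
    (pY := fun y => ∏ i, h.lawY (y i))
    (fun y => sum_prod_apply fun i u => h.lawUY u (y i))
    (Real.exp_pos (n * (h.infoUS + δ))).le (Real.exp_pos (n * (h.infoUY - δ))) hM0
    (fun s₂ u s₁ y => h.IsTypicalBlock δ s₂ u s₁ y)
    (fun s₂ u s₁ y hG => hG.prod_q_le)
    (fun s₂ u s₁ y hG => hG.le_prod_lawUY)
  refine ⟨e, D, le_trans (le_of_eq ?_) (hD.trans ?_)⟩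
  · congr! 10
  gcongr
  · exact h.sum_not_isTypicalBlock_le hδ hn
  · rw [div_le_iff₀ (by exact_mod_cast hM0)]
    refine le_trans (le_of_eq ?_) (mul_le_mul_of_nonneg_left hMge (Real.exp_pos _).le)
    rw [← Real.exp_add]
    ring_nf
  · rw [div_le_iff₀ (Real.exp_pos _), ← Real.exp_add]
    refine hMlt.trans (Real.exp_le_exp.2 ?_)
    have : (0 : ℝ) ≤ n := Nat.cast_nonneg n
    nlinarith

end HelperProblem.HybridChoice

/-! ### Cost and distortion of block codes -/

open Classical in
/-- A quantity at most `t` off an event of probability `η`, and bounded by `B`, has mean at most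
`t + (B + |t|) * η`. -/
lemma sum_mul_le_of_le_off {Ω : Type*} [Fintype Ω] {w : Ω → ℝ} (hw : w ∈ stdSimplex ℝ Ω)
    {F : Ω → ℝ} {A : Ω → Prop} {t B : ℝ} (hA : ∀ ω, A ω → F ω ≤ t) (hB : ∀ ω, F ω ≤ B)
    (hB0 : 0 ≤ B) {η : ℝ} (hη : ∑ ω, w ω * (if A ω then 0 else 1) ≤ η) :
    ∑ ω, w ω * F ω ≤ t + (B + |t|) * η := by
  have h1 : ∀ ω, F ω ≤ t + (B + |t|) * if A ω then 0 else 1 := by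
    intro ω
    split_ifs with h
    · simpa using hA ω h
    · have := hB ω
      have := neg_abs_le t
      linarith
  calc ∑ ω, w ω * F ω ≤ ∑ ω, w ω * (t + (B + |t|) * if A ω then 0 else 1) :=
        Finset.sum_le_sum fun ω _ => mul_le_mul_of_nonneg_left (h1 ω) (hw.1 ω)
    _ = t + (B + |t|) * ∑ ω, w ω * (if A ω then 0 else 1) := by
        simp only [mul_add (w _), Finset.sum_add_distrib, ← Finset.sum_mul, hw.2, one_mul,
          Finset.mul_sum]
        congr 1
        exact Finset.sum_congr rfl fun ω _ => by ring
    _ ≤ _ := by gcongr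

lemma sum_div_le_of_le {n : ℕ} {a : Fin n → ℝ} {B : ℝ} (hB0 : 0 ≤ B) (ha : ∀ i, a i ≤ B) :
    (∑ i, a i) / n ≤ B := by
  rcases Nat.eq_zero_or_pos n with rfl | hn
  · simpa using hB0
  · rw [div_le_iff₀ (by exact_mod_cast hn)]
    refine (Finset.sum_le_sum fun i _ => ha i).trans (le_of_eq ?_)
    simp [mul_comm]

lemma exists_nonneg_bound {α : Type*} [Finite α] (f : α → ℝ) : ∃ B, 0 ≤ B ∧ ∀ a, f a ≤ B := by
  obtain ⟨B, hB⟩ := (Set.finite_range f).bddAbove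
  exact ⟨max B 0, le_max_right _ _, fun a => (hB ⟨a, rfl⟩).trans (le_max_left _ _)⟩

namespace HelperProblem

variable {S₁ S₂ X Y R U : Type*} [Fintype S₁] [Fintype S₂] [Fintype X] [Fintype Y] [Fintype R]
  [Fintype U] {P : HelperProblem S₁ S₂ X Y R}

namespace HybridChoice

variable (h : P.HybridChoice U)

lemma blockLaw_eq {n : ℕ} (e : (Fin n → S₂) → (Fin n → U)) (s₁ : Fin n → S₁)
    (s₂ : Fin n → S₂) (y : Fin n → Y) :
    P.blockLaw (fun s i => h.f (s i) (e s i)) s₁ s₂ y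
      = (∏ i, P.p₂ (s₂ i)) * h.blockKernel s₂ (e s₂) s₁ y := by
  simp only [blockLaw, blockKernel]
  ring

/-- Block codes whose cost and distortion nearly match the single-letter values: failure of the
code in `exists_block_code` contributes a vanishing amount to both. -/
lemma exists_code_le {δ ε : ℝ} (hδ : 0 < δ) (hδε : δ < ε)
    (hI : h.infoUS + 4 * δ ≤ h.infoUY) :
    ∀ᶠ n : ℕ in atTop, ∃ (enc : (Fin n → S₂) → (Fin n → X)) (dec : (Fin n → Y) → (Fin n → R)),
      P.blockCost enc ≤ h.cost + ε ∧ P.blockDistortion enc dec ≤ h.distortion + ε := by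
  classical
  obtain ⟨B₁, hB₁0, hB₁⟩ := exists_nonneg_bound P.ρ
  obtain ⟨B₂, hB₂0, hB₂⟩ := exists_nonneg_bound fun a : S₁ × R => P.d a.1 a.2
  have hexp : Tendsto (fun n : ℕ => Real.exp (-(n * δ))) atTop (𝓝 0) :=
    Real.tendsto_exp_neg_atTop_nhds_zero.comp
      (tendsto_natCast_atTop_atTop.atTop_mul_const hδ)
  have hη : Tendsto (fun n : ℕ => 2 * (h.statMoment / δ ^ 2 / n) + √(Real.exp (-(n * δ)))
      + Real.exp (-(n * δ))) atTop (𝓝 0) := by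
    have h1 := (tendsto_const_div_atTop_nhds_zero_nat (h.statMoment / δ ^ 2)).const_mul 2
    have h2 := hexp.sqrt
    simpa using (h1.add h2).add hexp
  have hlim : ∀ t B : ℝ, ∀ᶠ n : ℕ in atTop, t + δ + (B + |t + δ|) *
      (2 * (h.statMoment / δ ^ 2 / n) + √(Real.exp (-(n * δ))) + Real.exp (-(n * δ)))
        < t + ε := by
    intro t B
    have := (hη.const_mul (B + |t + δ|)).const_add (t + δ)
    refine this.eventually_lt_const ?_
    rw [mul_zero]
    linarith
  filter_upwards [hlim h.cost B₁, hlim h.distortion B₂, eventually_gt_atTop 0] with n hn₁ hn₂ hn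
  obtain ⟨e, D, hD⟩ := h.exists_block_code hδ hI hn
  set η := 2 * (h.statMoment / δ ^ 2 / n) + √(Real.exp (-(n * δ))) + Real.exp (-(n * δ))
  -- The law of `(S₂ⁿ, S₁ⁿ, Yⁿ)` under this code.
  set w : (Fin n → S₂) × (Fin n → S₁) × (Fin n → Y) → ℝ := fun ω =>
    (∏ i, P.p₂ (ω.1 i)) * h.blockKernel ω.1 (e ω.1) ω.2.1 ω.2.2 with hw
  have hw1 : w ∈ stdSimplex ℝ _ := by
    refine ⟨fun ω => mul_nonneg (Finset.prod_nonneg fun i _ => P.p₂_mem.1 _)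
      (h.blockKernel_nonneg _ _ _ _), ?_⟩
    simp only [hw, Fintype.sum_prod_type, ← Finset.mul_sum, sum_blockKernel, mul_one]
    exact (prod_mem_stdSimplex fun i => P.p₂_mem).2
  have hfail : ∑ ω, w ω * (if D ω.2.2 = e ω.1 ∧
      h.IsTypicalBlock δ ω.1 (e ω.1) ω.2.1 ω.2.2 then 0 else 1) ≤ η := by
    simp only [hw, Fintype.sum_prod_type]
    refine le_trans (le_of_eq ?_) hD
    congr! 10
  refine ⟨fun s i => h.f (s i) (e s i), fun y i => h.g (D y i) (y i), ?_, ?_⟩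
  · have h1 := sum_mul_le_of_le_off hw1
      (F := fun ω => (∑ i, P.ρ (h.f (ω.1 i) (e ω.1 i))) / n) (t := h.cost + δ) (B := B₁)
      (A := fun ω => D ω.2.2 = e ω.1 ∧ h.IsTypicalBlock δ ω.1 (e ω.1) ω.2.1 ω.2.2)
      (fun ω hω => hω.2.cost_le hn)
      (fun ω => sum_div_le_of_le hB₁0 fun i => hB₁ _) hB₁0
      (le_trans (le_of_eq (by congr!)) hfail)
    refine le_trans (le_of_eq ?_) (h1.trans hn₁.le)
    simp only [hw, Fintype.sum_prod_type, ← Finset.sum_mul, ← Finset.mul_sum, sum_blockKernel,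
      mul_one, blockCost]
  · have h1 := sum_mul_le_of_le_off hw1
      (F := fun ω => (∑ i, P.d (ω.2.1 i) (h.g (D ω.2.2 i) (ω.2.2 i))) / n)
      (t := h.distortion + δ) (B := B₂)
      (A := fun ω => D ω.2.2 = e ω.1 ∧ h.IsTypicalBlock δ ω.1 (e ω.1) ω.2.1 ω.2.2)
      (fun ω hω => by
        rw [hω.1]
        exact hω.2.distortion_le hn)
      (fun ω => sum_div_le_of_le hB₂0 fun i =>
        hB₂ (ω.2.1 i, h.g (D ω.2.2 i) (ω.2.2 i))) hB₂0
      (le_trans (le_of_eq (by congr!)) hfail)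
    refine le_trans (le_of_eq ?_) (h1.trans hn₂.le)
    simp only [hw, Fintype.sum_prod_type, blockDistortion, blockLaw_eq]
    exact Finset.sum_comm

/-- Any single-letter choice meeting the information constraint is matched by block codes, up to
an arbitrarily small slack in cost and distortion. -/
lemma eventually_exists_code (hI : h.infoUS < h.infoUY) {ε : ℝ} (hε : 0 < ε) :
    ∀ᶠ n : ℕ in atTop, ∃ (enc : (Fin n → S₂) → (Fin n → X)) (dec : (Fin n → Y) → (Fin n → R)),
      P.blockCost enc ≤ h.cost + ε ∧ P.blockDistortion enc dec ≤ h.distortion + ε := by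
  refine h.exists_code_le (δ := min (ε / 2) ((h.infoUY - h.infoUS) / 4))
    (lt_min (by linarith) (by linarith)) ((min_le_left _ _).trans_lt (by linarith)) ?_
  have := min_le_right (ε / 2) ((h.infoUY - h.infoUS) / 4)
  linarith

/-- `E d` is bounded below uniformly in the auxiliary alphabet. -/
lemma le_distortion {B : ℝ} (hB : ∀ s r, B ≤ P.d s r) : B ≤ h.distortion := by
  rw [← mean_stat_three]
  calc B = ∑ ω, h.letterLaw ω * B := by rw [← Finset.sum_mul, sum_letterLaw, one_mul]
    _ ≤ _ := Finset.sum_le_sum fun ω _ =>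
      mul_le_mul_of_nonneg_left (hB _ _) (h.letterLaw_nonneg ω)

end HybridChoice

/-- If every positive slack is eventually enough, a vanishing slack can be chosen: take for each
block length the smallest slack of any pair of block maps. -/
lemma achievable_of_eventually {C D : ℝ} (hX : Nonempty X) (hR : Nonempty R)
    (hev : ∀ ε > 0, ∀ᶠ n : ℕ in atTop,
      ∃ (enc : (Fin n → S₂) → (Fin n → X)) (dec : (Fin n → Y) → (Fin n → R)),
        P.blockCost enc ≤ C + ε ∧ P.blockDistortion enc dec ≤ D + ε) :
    P.Achievable C D := by
  classical
  set slack : ∀ n : ℕ, ((Fin n → S₂) → (Fin n → X)) × ((Fin n → Y) → (Fin n → R)) → ℝ :=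
    fun n c => max (max (P.blockCost c.1 - C) (P.blockDistortion c.1 c.2 - D)) 0 with hslack
  have hmin : ∀ n, ∃ c, ∀ c', slack n c ≤ slack n c' := fun n => Finite.exists_min _
  choose c hc using hmin
  have hcost : ∀ n, P.blockCost (c n).1 ≤ C + slack n (c n) := fun n => by
    have : P.blockCost (c n).1 - C ≤ slack n (c n) := (le_max_left _ _).trans (le_max_left _ _)
    linarith
  have hdist : ∀ n, P.blockDistortion (c n).1 (c n).2 ≤ D + slack n (c n) := fun n => by
    have : P.blockDistortion (c n).1 (c n).2 - D ≤ slack n (c n) :=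
      (le_max_right _ _).trans (le_max_left _ _)
    linarith
  have hlim : Tendsto (fun n => slack n (c n)) atTop (𝓝 0) := by
    rw [Metric.tendsto_nhds]
    intro ε hε
    filter_upwards [hev (ε / 2) (half_pos hε)] with n hn
    obtain ⟨enc, dec, h1, h2⟩ := hn
    have h3 : slack n (enc, dec) ≤ ε / 2 :=
      max_le (max_le (by linarith) (by linarith)) (half_pos hε).le
    have h0 : 0 ≤ slack n (c n) := le_max_right _ _
    rw [Real.dist_eq, sub_zero, abs_of_nonneg h0]
    linarith [hc n (enc, dec)]
  refine ⟨fun n => slack n (c n), fun n => ⟨(c n).1, (c n).2, hcost n⟩, hlim, ?_⟩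
  have hDlim : Tendsto (fun n => ((D + slack n (c n) : ℝ) : EReal)) atTop (𝓝 (D : EReal)) := by
    refine (continuous_coe_real_ereal.tendsto D).comp ?_
    simpa using hlim.const_add D
  rw [← hDlim.limsup_eq]
  exact limsup_le_limsup (Eventually.of_forall fun n => EReal.coe_le_coe_iff.2 (hdist n))

lemma bddBelow_hybridDistortions (P : HelperProblem S₁ S₂ X Y R) (C : ℝ) :
    BddBelow (P.hybridDistortions C) := by
  obtain ⟨B, -, hB⟩ := exists_nonneg_bound fun a : S₁ × R => -P.d a.1 a.2
  refine ⟨-B, ?_⟩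
  rintro D ⟨k, h, -, -, rfl⟩
  exact h.le_distortion fun s r => by linarith [hB (s, r)]

lemma nonempty_of_mem_stdSimplex {α : Type*} [Fintype α] {w : α → ℝ} (hw : w ∈ stdSimplex ℝ α) :
    Nonempty α := by
  by_contra h
  rw [not_nonempty_iff] at h
  simpa using hw.2

lemma achievable_sInf_hybridDistortions (P : HelperProblem S₁ S₂ X Y R) (C : ℝ)
    (hne : (P.hybridDistortions C).Nonempty) :
    P.Achievable C (sInf (P.hybridDistortions C)) := by
  obtain ⟨k, h, -⟩ := hne.some_mem
  obtain ⟨s₁⟩ := nonempty_of_mem_stdSimplex P.p₁_mem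
  obtain ⟨s₂⟩ := nonempty_of_mem_stdSimplex P.p₂_mem
  obtain ⟨u⟩ := nonempty_of_mem_stdSimplex (h.q_mem s₂)
  obtain ⟨y⟩ := nonempty_of_mem_stdSimplex (P.W_mem (h.f s₂ u) s₁ s₂)
  refine achievable_of_eventually ⟨h.f s₂ u⟩ ⟨h.g u y⟩ fun ε hε => ?_
  obtain ⟨D, ⟨k', h', hI, hcost, rfl⟩, hlt⟩ :=
    exists_lt_of_csInf_lt hne (lt_add_of_pos_right (sInf (P.hybridDistortions C)) (half_pos hε))
  filter_upwards [h'.eventually_exists_code hI (half_pos hε)] with n hn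
  obtain ⟨enc, dec, h1, h2⟩ := hn
  exact ⟨enc, dec, by linarith, by linarith⟩

end HelperProblem

theorem theorem2 {S₁ S₂ X Y R : Type*}
    [Fintype S₁] [Fintype S₂] [Fintype X] [Fintype Y] [Fintype R]
    (P : HelperProblem S₁ S₂ X Y R) (C : ℝ) :
    P.minDistortion C ≤ (⨅ D ∈ P.hybridDistortions C, (D : EReal)) ∧
    ((P.hybridDistortions C).Nonempty →
      ∃ D : ℝ, IsGLB (P.hybridDistortions C) D ∧ P.Achievable C D) := by
  have hbdd := P.bddBelow_hybridDistortions C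
  refine ⟨le_iInf₂ fun D hD => ?_, fun hne => ⟨_, isGLB_csInf hne hbdd,
    P.achievable_sInf_hybridDistortions C hne⟩⟩
  calc P.minDistortion C ≤ (sInf (P.hybridDistortions C) : ℝ) :=
        iInf₂_le _ (P.achievable_sInf_hybridDistortions C ⟨D, hD⟩)
    _ ≤ D := EReal.coe_le_coe_iff.2 (csInf_le hbdd hD)
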